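/- Let $d, L \in \mathbb{N} = \{1,2,\dots\}$, let $w_0 := d$, let $w_1,\dots,w_L \in \mathbb{N}$ and $w_{L+1} := 1$, and let $K \subset \mathbb{R}^d$ be a nonempty compact set. Let $\sigma_1,\dots,\sigma_L \colon \mathbb{R} \to \mathbb{R}$ be continuous functions, none of which is a polynomial. Let $D$ be the set of all parameters $\alpha = \{(A_i,b_i)\}_{i=1}^{L+1}$ with $A_i \in \mathbb{R}^{w_i \times w_{i-1}}$ and $b_i \in \mathbb{R}^{w_i}$. For $\alpha \in D$, put $\varphi_i(z) := \sigma_i(A_i z + b_i)$ for $i=1,\dots,L$, with $\sigma_i$ acting componentwise, put $\varphi_{L+1}(z) := A_{L+1} z + b_{L+1}$, and let $\Psi(\alpha) \in C(K)$ be the restriction of $\varphi_{L+1} \circ \dots \circ \varphi_1 \colon \mathbb{R}^d \to \mathbb{R}$ to $K$. Let $\mathcal{M}(K)$ be the space of finite signed Radon measures on the Borel sets of $K$, and write $\langle \mu, z\rangle := \int_K z \, \mathrm{d}\mu$ for $\mu \in \mathcal{M}(K)$ and $z \in C(K)$. Then a measure $\mu \in \mathcal{M}(K)$ and a constant $c \in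 \mathbb{R}$ satisfy $$\langle \mu, z \rangle \le c \quad \text{for all } z \in \Psi(D)$$ if and only if $\mu = 0$ and $c \ge 0$. -/

import Mathlib

open MeasureTheory Matrix

noncomputable section

/-- The parameter space `D` of a fully connected feedforward network with `L` hidden layers.
`w 0 = d` is the input dimension and `w i`, `1 ≤ i ≤ L`, is the width of the `i`-th hidden layer;
the output is one-dimensional. The hidden layer with index `i : Fin L` (counted from `0`) maps
`ℝ ^ w i` to `ℝ ^ w (i + 1)`. -/
structure NetworkParams (L : ℕ) (w : Fin (L + 1) → ℕ) where
  /-- weights of the hidden layers -/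
  weight : ∀ i : Fin L, Matrix (Fin (w i.succ)) (Fin (w i.castSucc)) ℝ
  /-- biases of the hidden layers -/
  bias : ∀ i : Fin L, Fin (w i.succ) → ℝ
  /-- weights of the affine output layer -/
  outWeight : Matrix (Fin 1) (Fin (w (Fin.last L))) ℝ
  /-- bias of the affine output layer -/
  outBias : Fin 1 → ℝ

namespace NetworkParams

variable {L : ℕ} {w : Fin (L + 1) → ℕ}

/-- The composition of the first `i` hidden layers, evaluated at the input `x`; the activation
functions act componentwise. -/
def hiddenOutput (σ : Fin L → C(ℝ, ℝ)) (α : NetworkParams L w)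
    (x : EuclideanSpace ℝ (Fin (w 0))) : (i : Fin (L + 1)) → Fin (w i) → ℝ :=
  Fin.induction (motive := fun i => Fin (w i) → ℝ) (fun j => x j)
    (fun i z j => σ i ((α.weight i *ᵥ z + α.bias i) j))

/-- The network function `ψ(α, x)`: the affine output layer applied to the last hidden layer. -/
def eval (σ : Fin L → C(ℝ, ℝ)) (α : NetworkParams L w)
    (x : EuclideanSpace ℝ (Fin (w 0))) : ℝ :=
  (α.outWeight *ᵥ α.hiddenOutput σ x (Fin.last L) + α.outBias) 0

theorem continuous_hiddenOutput (σ : Fin L → C(ℝ, ℝ)) (α : NetworkParams L w)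
    (i : Fin (L + 1)) : Continuous fun x => α.hiddenOutput σ x i := by
  induction i using Fin.induction with
  | zero =>
    refine continuous_pi fun j => ?_
    simp only [hiddenOutput, Fin.induction_zero]
    fun_prop
  | succ i ih =>
    have h : (fun x => α.hiddenOutput σ x i.succ) =
        fun x j => σ i ((α.weight i *ᵥ α.hiddenOutput σ x i.castSucc + α.bias i) j) := by
      funext x
      simp only [hiddenOutput, Fin.induction_succ]
    rw [h]
    refine continuous_pi fun j => (σ i).continuous.comp ?_
    exact (continuous_apply j).comp ((continuous_const.matrix_mulVec ih).add continuous_const)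

theorem continuous_eval (σ : Fin L → C(ℝ, ℝ)) (α : NetworkParams L w) :
    Continuous (α.eval σ) :=
  (continuous_apply (0 : Fin 1)).comp ((continuous_const.matrix_mulVec
    (α.continuous_hiddenOutput σ (Fin.last L))).add continuous_const)

/-- The operator `Ψ : D → C(K)`, `Ψ(α) = ψ(α, ·)` restricted to `K`. -/
def toContinuousMap (σ : Fin L → C(ℝ, ℝ)) (K : Set (EuclideanSpace ℝ (Fin (w 0))))
    (α : NetworkParams L w) : C(K, ℝ) :=
  ⟨fun x => α.eval σ x, (α.continuous_eval σ).comp continuous_subtype_val⟩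

end NetworkParams

/-- A real function is polynomial if it is the evaluation of a real polynomial. -/
def IsPolynomialFunction (f : ℝ → ℝ) : Prop :=
  ∃ p : Polynomial ℝ, ∀ x, f x = p.eval x

/-- The dual pairing `⟨μ, z⟩ = ∫ z dμ` of a finite signed Borel measure `μ` and a continuous
function `z`, through the Jordan decomposition `μ = μ⁺ - μ⁻`. It is used for compact metrizable
`X`, where every finite signed Borel measure is Radon and every continuous `z` is integrable. -/
def measurePairing {X : Type*} [TopologicalSpace X] [MeasurableSpace X]
    (μ : SignedMeasure X) (z : C(X, ℝ)) : ℝ :=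
  ∫ x, z x ∂μ.toJordanDecomposition.posPart - ∫ x, z x ∂μ.toJordanDecomposition.negPart

end

/-! Network functions are closed under scaling, so an upper bound on the pairing forces it to vanish
on all of them: the Jordan parts `P`, `N` of μ have equal integrals of every network function. This
equality is carried backwards through the layers. If it holds for all outputs of one layer, then for
each linear form `g` of the preceding layer it holds for all `σ (a * g + b)`. By
`integral_comp_eq_of_integral_comp_affine_eq` it then holds for every continuous function of `g`, in
particular for `g` itself. At the input, `g` is a linear form on the ambient space, and cosines and
sines of linear forms determine a measure. The one-variable step mollifies σ, differentiates in `a`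
at `a = 0` to obtain the moments of `g`, and concludes by Weierstrass approximation. -/

/-! ### Polynomials and mollification -/

open Filter Topology in
/-- A pointwise limit of polynomial functions of uniformly bounded degree is polynomial. -/
theorem isPolynomialFunction_of_tendsto {k : ℕ} {f : ℝ → ℝ} {p : ℕ → Polynomial ℝ}
    (hp : ∀ n, (p n).degree < k)
    (hf : ∀ x, Tendsto (fun n => (p n).eval x) atTop (𝓝 (f x))) :
    IsPolynomialFunction f := by
  have hinj : Set.InjOn (fun i : ℕ => (i : ℝ)) (Finset.range k : Set ℕ) :=
    fun _ _ _ _ h => Nat.cast_injective h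
  refine ⟨Lagrange.interpolate (Finset.range k) (fun i : ℕ => (i : ℝ)) fun i => f i, fun x => ?_⟩
  refine tendsto_nhds_unique (hf x) ?_
  -- Degree below `k` means that the values at 0, ..., k - 1 determine the polynomial, so limits can
  -- be taken at these nodes.
  have h : ∀ n, (p n).eval x = ∑ i ∈ Finset.range k,
      (p n).eval (i : ℝ) * (Lagrange.basis (Finset.range k) (fun i : ℕ => (i : ℝ)) i).eval x := by
    intro n
    conv_lhs => rw [Lagrange.eq_interpolate (f := p n) hinj (by simpa using hp n)]
    simp [Lagrange.interpolate_apply, Polynomial.eval_finsetSum]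
  simp only [h, Lagrange.interpolate_apply, Polynomial.eval_finsetSum, Polynomial.eval_mul,
    Polynomial.eval_C]
  exact tendsto_finsetSum _ fun i _ => (hf i).mul_const _

/-- A smooth function whose `k`-th derivative vanishes is a power sum of length `k`. -/
theorem exists_powerSum_of_iteratedDeriv_eq_zero (k : ℕ) {f : ℝ → ℝ}
    (hf : ContDiff ℝ (⊤ : ℕ∞) f) (h : ∀ x, iteratedDeriv k f x = 0) :
    ∃ c : ℕ → ℝ, ∀ x, f x = ∑ i ∈ Finset.range k, c i * x ^ i := by
  induction k generalizing f with
  | zero => exact ⟨0, fun x => by simpa using h x⟩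
  | succ k ih =>
    obtain ⟨c, hc⟩ := ih (f := deriv f) ((contDiff_infty_iff_deriv.1 hf).2)
      (fun x => by rw [← iteratedDeriv_succ']; exact h x)
    let S : ℝ → ℝ := fun x => ∑ i ∈ Finset.range k, c i / (i + 1) * x ^ (i + 1)
    have hS : ∀ x, HasDerivAt S (deriv f x) x := by
      intro x
      rw [hc]
      refine HasDerivAt.fun_sum fun i _ => ?_
      refine ((hasDerivAt_pow (i + 1) x).const_mul (c i / (i + 1))).congr_deriv ?_
      have : (i + 1 : ℝ) ≠ 0 := by positivity
      simp only [Nat.add_sub_cancel, Nat.cast_add, Nat.cast_one]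
      field_simp
    have hfd : Differentiable ℝ f := (contDiff_infty_iff_deriv.1 hf).1
    have hconst : ∀ x, f x - S x = f 0 - S 0 := fun x =>
      is_const_of_deriv_eq_zero (f := fun x => f x - S x)
        (fun y => ((hfd y).hasDerivAt.sub (hS y)).differentiableAt)
        (fun y => (((hfd y).hasDerivAt.sub (hS y)).deriv).trans (sub_self _)) x 0
    refine ⟨fun i => if i = 0 then f 0 - S 0 else c (i - 1) / ((i - 1 : ℕ) + 1), fun x => ?_⟩
    rw [Finset.sum_range_succ']
    simpa [S, add_comm] using eq_add_of_sub_eq (hconst x)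

/-- A smooth function whose `k`-th derivative vanishes is a polynomial of degree less than `k`. -/
theorem exists_polynomial_of_iteratedDeriv_eq_zero {k : ℕ} {f : ℝ → ℝ}
    (hf : ContDiff ℝ (⊤ : ℕ∞) f) (h : ∀ x, iteratedDeriv k f x = 0) :
    ∃ p : Polynomial ℝ, p.degree < k ∧ ∀ x, f x = p.eval x := by
  obtain ⟨c, hc⟩ := exists_powerSum_of_iteratedDeriv_eq_zero k hf h
  refine ⟨∑ i ∈ Finset.range k, Polynomial.C (c i) * Polynomial.X ^ i, ?_, fun x => ?_⟩
  · rw [← Polynomial.mem_degreeLT]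
    refine Submodule.sum_mem _ fun i hi => Polynomial.mem_degreeLT.2 ?_
    exact (Polynomial.degree_C_mul_X_pow_le _ _).trans_lt
      (by exact_mod_cast Finset.mem_range.1 hi)
  · simp [hc, Polynomial.eval_finsetSum]

open Filter Topology in
/-- Some smooth mollification of a continuous non-polynomial function has a nonvanishing `k`-th
derivative. -/
theorem exists_mollification_iteratedDeriv_ne_zero {σ : ℝ → ℝ} (hσc : Continuous σ)
    (hσ : ¬ IsPolynomialFunction σ) (k : ℕ) :
    ∃ φ : ℝ → ℝ, Continuous φ ∧ HasCompactSupport φ ∧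
      ContDiff ℝ (⊤ : ℕ∞) (fun y => ∫ s, φ s * σ (y - s)) ∧
      ∃ b, iteratedDeriv k (fun y => ∫ s, φ s * σ (y - s)) b ≠ 0 := by
  by_contra! hcon
  -- The supports shrink to 0, so the mollifications converge pointwise to σ.
  let φ : ℕ → ContDiffBump (0 : ℝ) := fun n =>
    ⟨1 / (2 * ((n : ℝ) + 1)), 1 / ((n : ℝ) + 1), by positivity, by
      rw [div_lt_div_iff₀ (by positivity) (by positivity)]
      have : (0 : ℝ) ≤ n := n.cast_nonneg
      linarith⟩
  have hsmooth : ∀ n, ContDiff ℝ (⊤ : ℕ∞) (fun y => ∫ s, (φ n).normed volume s * σ (y - s)) :=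
    fun n => HasCompactSupport.contDiff_convolution_left (ContinuousLinearMap.lsmul ℝ ℝ)
      (φ n).hasCompactSupport_normed (φ n).contDiff_normed hσc.locallyIntegrable
  have hzero := fun n => hcon ((φ n).normed volume) (φ n).continuous_normed
    (φ n).hasCompactSupport_normed (hsmooth n)
  choose p hpdeg hp using fun n => exists_polynomial_of_iteratedDeriv_eq_zero (hsmooth n) (hzero n)
  refine hσ (isPolynomialFunction_of_tendsto hpdeg fun x => ?_)
  simp only [← hp]
  exact ContDiffBump.convolution_tendsto_right_of_continuous (μ := volume) (φ := φ)
    tendsto_one_div_add_atTop_nhds_zero_nat hσc x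

/-! ### One-variable density, tested against measures -/

section CompactSpace

variable {X : Type*} [TopologicalSpace X] [CompactSpace X] [MeasurableSpace X] [BorelSpace X]

theorem integrable_continuous_of_compactSpace (P : Measure X) [IsFiniteMeasure P] {f : X → ℝ}
    (hf : Continuous f) : Integrable f P :=
  hf.integrable_of_hasCompactSupport (HasCompactSupport.of_compactSpace f)

open Metric in
theorem hasDerivAt_integral_pow_mul_comp_affine (P : Measure X) [IsFiniteMeasure P] (g : C(X, ℝ))
    {f : ℝ → ℝ} (hf : ContDiff ℝ 1 f) (j : ℕ) (a b : ℝ) :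
    HasDerivAt (fun a => ∫ x, g x ^ j * f (a * g x + b) ∂P)
      (∫ x, g x ^ (j + 1) * deriv f (a * g x + b) ∂P) a := by
  have hdc : Continuous (deriv f) := hf.continuous_deriv le_rfl
  have hfd : Differentiable ℝ f := hf.differentiable one_ne_zero
  have hcont : Continuous fun q : ℝ × X => g q.2 ^ (j + 1) * deriv f (q.1 * g q.2 + b) := by
    fun_prop
  obtain ⟨C, hC⟩ := ((isCompact_closedBall a 1).prod
    (isCompact_univ (X := X))).exists_bound_of_continuousOn hcont.continuousOn
  refine (hasDerivAt_integral_of_dominated_loc_of_deriv_le (bound := fun _ => C)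
    (F' := fun a x => g x ^ (j + 1) * deriv f (a * g x + b))
    (closedBall_mem_nhds a one_pos) (.of_forall fun t => ?_) ?_ ?_
    (.of_forall fun x t ht => hC (t, x) ⟨ht, trivial⟩) (integrable_const C)
    (.of_forall fun x t _ => ?_)).2
  · exact (integrable_continuous_of_compactSpace P (by fun_prop)).aestronglyMeasurable
  · exact integrable_continuous_of_compactSpace P (by fun_prop)
  · exact (integrable_continuous_of_compactSpace P (by fun_prop)).aestronglyMeasurable
  · have h1 : HasDerivAt (fun t : ℝ => t * g x + b) (g x) t := by
      simpa using ((hasDerivAt_id t).mul_const (g x)).add_const b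
    refine (((hfd _).hasDerivAt.comp t h1).const_mul (g x ^ j)).congr_deriv ?_
    ring

variable {P N : Measure X} [IsFiniteMeasure P] [IsFiniteMeasure N]

/-- Each derivative in `a` under the integral sign brings out one factor `g x`. -/
theorem integral_pow_mul_iteratedDeriv_eq {g : C(X, ℝ)} {f : ℝ → ℝ}
    (hf : ContDiff ℝ (⊤ : ℕ∞) f)
    (h : ∀ a b : ℝ, ∫ x, f (a * g x + b) ∂P = ∫ x, f (a * g x + b) ∂N) (k : ℕ) (a b : ℝ) :
    ∫ x, g x ^ k * iteratedDeriv k f (a * g x + b) ∂P =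
      ∫ x, g x ^ k * iteratedDeriv k f (a * g x + b) ∂N := by
  induction k generalizing a with
  | zero => simpa using h a b
  | succ k ih =>
    have hk : ContDiff ℝ 1 (iteratedDeriv k f) := by
      rw [iteratedDeriv_eq_iterate]
      exact ContDiff.iterate_deriv' 1 k (hf.of_le (by exact_mod_cast le_top))
    have hP := hasDerivAt_integral_pow_mul_comp_affine P g hk k a b
    have hN := hasDerivAt_integral_pow_mul_comp_affine N g hk k a b
    rw [iteratedDeriv_succ]
    exact hP.unique (by simpa only [ih] using hN)

variable [T2Space X]

/-- Fubini's theorem for a mollified ridge function. -/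
theorem integral_mollification_comp (P : Measure X) [IsFiniteMeasure P] (g : C(X, ℝ))
    {φ σ : ℝ → ℝ} (hφ : Continuous φ) (hφs : HasCompactSupport φ) (hσ : Continuous σ) (a b : ℝ) :
    ∫ x, (∫ s, φ s * σ (a * g x + b - s)) ∂P =
      ∫ s, φ s * (∫ x, σ (a * g x + (b - s)) ∂P) := by
  rw [integral_integral_swap_of_hasCompactSupport (f := fun x s => φ s * σ (a * g x + b - s))
    (by simp only [Function.uncurry_def]; fun_prop)]
  · simp only [integral_const_mul, add_sub_assoc]
  · refine HasCompactSupport.intro ((isCompact_univ (X := X)).prod hφs) fun q hq => ?_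
    have : φ q.2 = 0 := image_eq_zero_of_notMem_tsupport fun h => hq ⟨trivial, h⟩
    simp [Function.uncurry_def, this]

/-- Mollifying only averages over the bias, so the hypothesis passes to the smooth mollification. At
`a = 0` its `k`-th derivative is a nonzero constant, which cancels. -/
theorem integral_pow_eq_of_integral_comp_affine_eq {g : C(X, ℝ)} {σ : ℝ → ℝ}
    (hσc : Continuous σ) (hσ : ¬ IsPolynomialFunction σ)
    (h : ∀ a b : ℝ, ∫ x, σ (a * g x + b) ∂P = ∫ x, σ (a * g x + b) ∂N) (k : ℕ) :
    ∫ x, g x ^ k ∂P = ∫ x, g x ^ k ∂N := by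
  obtain ⟨φ, hφ, hφs, hsmooth, b, hb⟩ := exists_mollification_iteratedDeriv_ne_zero hσc hσ k
  have := integral_pow_mul_iteratedDeriv_eq (P := P) (N := N) (g := g) hsmooth
    (fun a b => by
      rw [integral_mollification_comp P g hφ hφs hσc, integral_mollification_comp N g hφ hφs hσc]
      simp only [h]) k 0 b
  simpa [integral_mul_const, hb] using this

/-- If two finite measures on a compact space agree on all functions `σ (a g + b)` with `σ`
continuous and not polynomial, then they agree on every continuous function of `g`. -/
theorem integral_comp_eq_of_integral_comp_affine_eq {g : C(X, ℝ)} {σ : ℝ → ℝ}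
    (hσc : Continuous σ) (hσ : ¬ IsPolynomialFunction σ)
    (h : ∀ a b : ℝ, ∫ x, σ (a * g x + b) ∂P = ∫ x, σ (a * g x + b) ∂N)
    {f : ℝ → ℝ} (hf : Continuous f) :
    ∫ x, f (g x) ∂P = ∫ x, f (g x) ∂N := by
  have hpoly : ∀ p : Polynomial ℝ, ∫ x, p.eval (g x) ∂P = ∫ x, p.eval (g x) ∂N := by
    intro p
    simp only [Polynomial.eval_eq_sum_range]
    rw [integral_finsetSum _ fun i _ => integrable_continuous_of_compactSpace P (by fun_prop),
      integral_finsetSum _ fun i _ => integrable_continuous_of_compactSpace N (by fun_prop)]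
    simp only [integral_const_mul, integral_pow_eq_of_integral_comp_affine_eq hσc hσ h]
  obtain ⟨M, hM⟩ := (isCompact_univ (X := X)).exists_bound_of_continuousOn g.continuous.continuousOn
  have hclose : ∀ (Q : Measure X) [IsFiniteMeasure Q] (p : Polynomial ℝ) (ε : ℝ),
      (∀ x ∈ Set.Icc (-M) M, |p.eval x - f x| < ε) →
      |∫ x, p.eval (g x) ∂Q - ∫ x, f (g x) ∂Q| ≤ ε * Q.real Set.univ := by
    intro Q _ p ε hp
    rw [← integral_sub (integrable_continuous_of_compactSpace Q (by fun_prop))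
      (integrable_continuous_of_compactSpace Q (by fun_prop))]
    exact norm_integral_le_of_norm_le_const (f := fun x => p.eval (g x) - f (g x))
      (.of_forall fun x => (hp _ (abs_le.1 (hM x trivial))).le)
  refine eq_of_forall_dist_le fun ε hε => ?_
  -- The summand 1 keeps `T` positive when both measures vanish.
  set T := P.real Set.univ + N.real Set.univ + 1
  have hT : 0 < T := by positivity
  obtain ⟨p, hp⟩ := exists_polynomial_near_of_continuousOn (-M) M f hf.continuousOn (ε / T)
    (by positivity)
  have hP := hclose P p _ hp
  have hN := hclose N p _ hp
  rw [hpoly p] at hP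
  rw [Real.dist_eq]
  calc |∫ x, f (g x) ∂P - ∫ x, f (g x) ∂N|
      ≤ ε / T * P.real Set.univ + ε / T * N.real Set.univ := by
        rw [abs_sub_le_iff]
        rw [abs_le] at hP hN
        constructor <;> linarith
    _ ≤ ε / T * T := by
        rw [← mul_add]
        gcongr
        simp [T]
    _ = ε := div_mul_cancel₀ _ hT.ne'

end CompactSpace

/-! ### Peeling off layers -/

namespace NetworkParams

variable {L : ℕ} {w : Fin (L + 1) → ℕ}

@[simp]
theorem hiddenOutput_zero (σ : Fin L → C(ℝ, ℝ)) (α : NetworkParams L w)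
    (x : EuclideanSpace ℝ (Fin (w 0))) : α.hiddenOutput σ x 0 = fun j => x j := rfl

theorem hiddenOutput_succ (σ : Fin L → C(ℝ, ℝ)) (α : NetworkParams L w)
    (x : EuclideanSpace ℝ (Fin (w 0))) (i : Fin L) :
    α.hiddenOutput σ x i.succ =
      fun j => σ i ((α.weight i *ᵥ α.hiddenOutput σ x i.castSucc + α.bias i) j) := by
  simp only [hiddenOutput, Fin.induction_succ]

/-- The output of a layer depends only on the preceding layers. -/
theorem hiddenOutput_congr (σ : Fin L → C(ℝ, ℝ)) {α β : NetworkParams L w}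
    (x : EuclideanSpace ℝ (Fin (w 0))) (i : Fin (L + 1))
    (hw : ∀ k : Fin L, k.castSucc < i → α.weight k = β.weight k)
    (hb : ∀ k : Fin L, k.castSucc < i → α.bias k = β.bias k) :
    α.hiddenOutput σ x i = β.hiddenOutput σ x i := by
  induction i using Fin.induction with
  | zero => rfl
  | succ i ih =>
    have hi : i.castSucc < i.succ := Fin.castSucc_lt_succ
    rw [hiddenOutput_succ, hiddenOutput_succ, hw i hi, hb i hi,
      ih (fun k hk => hw k (hk.trans hi)) fun k hk => hb k (hk.trans hi)]

/-- Replace layer `i` by one all of whose neurons have weights `v` and bias `b`. -/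
def replaceLayer (α : NetworkParams L w) (i : Fin L) (v : Fin (w i.castSucc) → ℝ) (b : ℝ) :
    NetworkParams L w where
  weight := Function.update α.weight i (Matrix.of fun _ => v)
  bias := Function.update α.bias i fun _ => b
  outWeight := α.outWeight
  outBias := α.outBias

theorem hiddenOutput_replaceLayer (σ : Fin L → C(ℝ, ℝ)) (α : NetworkParams L w) (i : Fin L)
    (v : Fin (w i.castSucc) → ℝ) (b : ℝ) (x : EuclideanSpace ℝ (Fin (w 0)))
    (j : Fin (w i.succ)) :
    (α.replaceLayer i v b).hiddenOutput σ x i.succ j =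
      σ i (v ⬝ᵥ α.hiddenOutput σ x i.castSucc + b) := by
  have h : (α.replaceLayer i v b).hiddenOutput σ x i.castSucc = α.hiddenOutput σ x i.castSucc := by
    refine hiddenOutput_congr σ x _ (fun k hk => ?_) fun k hk => ?_ <;>
    · have : k ≠ i := by rintro rfl; exact lt_irrefl _ hk
      simp [replaceLayer, this]
  rw [hiddenOutput_succ, h]
  simp [replaceLayer, Matrix.mulVec]

/-- Multiply the output of a network by a scalar. -/
def scaleOutput (α : NetworkParams L w) (t : ℝ) : NetworkParams L w where
  weight := α.weight
  bias := α.bias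
  outWeight := t • α.outWeight
  outBias := t • α.outBias

theorem toContinuousMap_scaleOutput (σ : Fin L → C(ℝ, ℝ))
    (K : Set (EuclideanSpace ℝ (Fin (w 0)))) (α : NetworkParams L w) (t : ℝ) :
    (α.scaleOutput t).toContinuousMap σ K = t • α.toContinuousMap σ K := by
  ext x
  change (α.scaleOutput t).eval σ x = t * α.eval σ x
  have h : (α.scaleOutput t).hiddenOutput σ x (Fin.last L) = α.hiddenOutput σ x (Fin.last L) :=
    hiddenOutput_congr σ x _ (α := α.scaleOutput t) (β := α) (fun _ _ => rfl) fun _ _ => rfl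
  rw [eval, h]
  simp [eval, scaleOutput, Matrix.smul_mulVec, mul_add]

variable {K : Set (EuclideanSpace ℝ (Fin (w 0)))} [CompactSpace K] {P N : Measure K}
  [IsFiniteMeasure P] [IsFiniteMeasure N] {σ : Fin L → C(ℝ, ℝ)}

/-- If two measures agree on the outputs of layer `i + 1` of every network, they agree on all
continuous ridge functions of the outputs of layer `i`. -/
theorem integral_comp_dotProduct_hiddenOutput_eq {i : Fin L} (hw : 1 ≤ w i.succ)
    (hσ : ¬ IsPolynomialFunction (σ i))
    (h : ∀ (α : NetworkParams L w) (v : Fin (w i.succ) → ℝ),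
      ∫ x : K, v ⬝ᵥ α.hiddenOutput σ x i.succ ∂P = ∫ x : K, v ⬝ᵥ α.hiddenOutput σ x i.succ ∂N)
    (α : NetworkParams L w) (v : Fin (w i.castSucc) → ℝ) {f : ℝ → ℝ} (hf : Continuous f) :
    ∫ x : K, f (v ⬝ᵥ α.hiddenOutput σ x i.castSucc) ∂P =
      ∫ x : K, f (v ⬝ᵥ α.hiddenOutput σ x i.castSucc) ∂N := by
  let g : C(K, ℝ) := ⟨fun x => v ⬝ᵥ α.hiddenOutput σ x i.castSucc,
    continuous_const.dotProduct
      ((α.continuous_hiddenOutput σ i.castSucc).comp continuous_subtype_val)⟩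
  refine integral_comp_eq_of_integral_comp_affine_eq (g := g) (σ i).continuous hσ
    (fun a b => ?_) hf
  -- Reading off a single neuron suffices; positive width provides one.
  have := h (α.replaceLayer i (a • v) b) (Pi.single ⟨0, hw⟩ 1)
  simpa [hiddenOutput_replaceLayer, smul_dotProduct, g] using this

/-- Measures that agree on all network functions agree on the outputs of all hidden layers. -/
theorem integral_dotProduct_hiddenOutput_eq (hw : ∀ i, 1 ≤ w i)
    (hσ : ∀ i, ¬ IsPolynomialFunction (σ i))
    (h : ∀ α : NetworkParams L w, ∫ x, α.toContinuousMap σ K x ∂P = ∫ x, α.toContinuousMap σ K x ∂N)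
    (i : Fin (L + 1)) (α : NetworkParams L w) (v : Fin (w i) → ℝ) :
    ∫ x : K, v ⬝ᵥ α.hiddenOutput σ x i ∂P = ∫ x : K, v ⬝ᵥ α.hiddenOutput σ x i ∂N := by
  induction i using Fin.reverseInduction generalizing α with
  | last =>
    have heval : ∀ x : K, (NetworkParams.mk α.weight α.bias (Matrix.of fun _ => v) 0).toContinuousMap
        σ K x = v ⬝ᵥ α.hiddenOutput σ x (Fin.last L) := by
      intro x
      have hx := hiddenOutput_congr σ (x : EuclideanSpace ℝ (Fin (w 0))) (Fin.last L)
        (α := NetworkParams.mk α.weight α.bias (Matrix.of fun _ => v) 0) (β := α)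
        (fun _ _ => rfl) fun _ _ => rfl
      change (NetworkParams.mk α.weight α.bias (Matrix.of fun _ => v) 0).eval σ x = _
      simp [eval, hx, Matrix.mulVec]
    simpa only [heval] using h (NetworkParams.mk α.weight α.bias (Matrix.of fun _ => v) 0)
  | cast i ih =>
    exact integral_comp_dotProduct_hiddenOutput_eq (hw _) (hσ i) ih α v continuous_id

end NetworkParams

/-! ### From ridge functions to the measure -/

/-- Taking `f` to be cosine and sine gives equal characteristic functions of the pushforwards to
`E`. -/
theorem measure_eq_of_integral_comp_inner_eq {E : Type*} [NormedAddCommGroup E]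
    [InnerProductSpace ℝ E] [CompleteSpace E] [SecondCountableTopology E] [MeasurableSpace E]
    [BorelSpace E] {K : Set E} [CompactSpace K] {P N : Measure K}
    [IsFiniteMeasure P] [IsFiniteMeasure N]
    (h : ∀ (v : E) (f : ℝ → ℝ), Continuous f →
      ∫ x : K, f (inner ℝ (x : E) v) ∂P = ∫ x : K, f (inner ℝ (x : E) v) ∂N) : P = N := by
  have hK : MeasurableSet K := (isCompact_iff_compactSpace.2 ‹_›).measurableSet
  have hemb := MeasurableEmbedding.subtype_coe hK
  have hcos : ∀ v : E, Continuous fun x : K => Real.cos (inner ℝ (x : E) v) :=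
    fun v => Real.continuous_cos.comp (by fun_prop)
  have hsin : ∀ v : E, Continuous fun x : K => Real.sin (inner ℝ (x : E) v) :=
    fun v => Real.continuous_sin.comp (by fun_prop)
  have hchar : ∀ (Q : Measure K) [IsFiniteMeasure Q] (v : E),
      charFun (Q.map ((↑) : K → E)) v =
        ((∫ x : K, Real.cos (inner ℝ (x : E) v) ∂Q : ℝ) : ℂ) +
          ((∫ x : K, Real.sin (inner ℝ (x : E) v) ∂Q : ℝ) : ℂ) * Complex.I := by
    intro Q _ v
    rw [charFun_apply, hemb.integral_map, ← integral_complex_ofReal, ← integral_complex_ofReal,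
      ← integral_mul_const, ← integral_add]
    · simp only [Complex.exp_mul_I, Complex.ofReal_cos, Complex.ofReal_sin]
    · exact (integrable_continuous_of_compactSpace Q (hcos v)).ofReal
    · exact (integrable_continuous_of_compactSpace Q (hsin v)).ofReal.mul_const _
  have hmap : P.map ((↑) : K → E) = N.map ((↑) : K → E) := by
    refine Measure.ext_of_charFun (funext fun v => ?_)
    rw [hchar, hchar, h v _ Real.continuous_cos, h v _ Real.continuous_sin]
  ext s hs
  have := congrArg (fun Q => Q (((↑) : K → E) '' s)) hmap
  simpa [hemb.map_apply, Set.preimage_image_eq _ Subtype.val_injective] using this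

theorem measurePairing_smul {X : Type*} [TopologicalSpace X] [MeasurableSpace X]
    (μ : SignedMeasure X) (t : ℝ) (z : C(X, ℝ)) :
    measurePairing μ (t • z) = t * measurePairing μ z := by
  simp [measurePairing, integral_const_mul, mul_sub]

theorem measurePairing_zero_left {X : Type*} [TopologicalSpace X] [MeasurableSpace X]
    (z : C(X, ℝ)) : measurePairing (0 : SignedMeasure X) z = 0 := by
  simp [measurePairing, SignedMeasure.toJordanDecomposition_zero]

theorem signedMeasure_eq_zero_of_posPart_eq_negPart {X : Type*} [MeasurableSpace X]
    {μ : SignedMeasure X}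
    (h : μ.toJordanDecomposition.posPart = μ.toJordanDecomposition.negPart) : μ = 0 := by
  rw [← μ.toSignedMeasure_toJordanDecomposition, JordanDecomposition.toSignedMeasure, sub_eq_zero]
  congr 1

theorem theorem4p2 (L : ℕ) (hL : 1 ≤ L) (w : Fin (L + 1) → ℕ) (hw : ∀ i, 1 ≤ w i)
    (K : Set (EuclideanSpace ℝ (Fin (w 0)))) (hKne : K.Nonempty) (hK : IsCompact K)
    (σ : Fin L → C(ℝ, ℝ)) (hσ : ∀ i, ¬ IsPolynomialFunction (σ i))
    (μ : SignedMeasure K) (c : ℝ) :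
    (∀ z ∈ Set.range (NetworkParams.toContinuousMap (w := w) σ K), measurePairing μ z ≤ c) ↔
      μ = 0 ∧ 0 ≤ c := by
  constructor
  · intro h
    have hscale : ∀ (t : ℝ) (α : NetworkParams L w),
        t * measurePairing μ (α.toContinuousMap σ K) ≤ c := by
      intro t α
      rw [← measurePairing_smul, ← NetworkParams.toContinuousMap_scaleOutput]
      exact h _ ⟨_, rfl⟩
    have hc : 0 ≤ c := by simpa using hscale 0 ⟨0, 0, 0, 0⟩
    refine ⟨?_, hc⟩
    have hzero : ∀ α : NetworkParams L w, measurePairing μ (α.toContinuousMap σ K) = 0 := by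
      intro α
      by_contra hne
      -- This factor would scale the pairing to `c + 1`.
      have := hscale ((c + 1) / measurePairing μ (α.toContinuousMap σ K)) α
      rw [div_mul_cancel₀ _ hne] at this
      linarith
    have : CompactSpace K := isCompact_iff_compactSpace.1 hK
    have hlayer := NetworkParams.integral_dotProduct_hiddenOutput_eq hw hσ
      fun α => sub_eq_zero.1 (hzero α)
    refine signedMeasure_eq_zero_of_posPart_eq_negPart
      (measure_eq_of_integral_comp_inner_eq fun v f hf => ?_)
    -- The input of the first hidden layer is `x` itself, whatever the parameters.
    have := NetworkParams.integral_comp_dotProduct_hiddenOutput_eq (i := ⟨0, hL⟩) (hw _) (hσ _)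
      (hlayer _) ⟨0, 0, 0, 0⟩ (fun j => v j) hf
    exact this
  · rintro ⟨rfl, hc⟩ z -
    rwa [measurePairing_zero_left]
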